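/- **Setting.** There are $N$ agents; agent $i$ chooses $x_i\in X_i\subseteq\mathbb R^n$, and $x=(x_1,\dots,x_N)$. Agent $i$ has a sample $\xi_i^{(1)},\dots,\xi_i^{(K_i)}\in\mathbb R^m$ ($m\ge1$, $K_i\ge 1$) and a radius $\varepsilon_i\ge 0$. Let $\hat{\mathbb P}_{K_i}=\frac1{K_i}\sum_k\delta_{\xi_i^{(k)}}$, let $$d_W(\mathbb Q,\mathbb Q')=\Big(\inf_{\Pi}\int\|\xi-\xi'\|^2\,\Pi(d\xi,d\xi')\Big)^{1/2}$$ be the Wasserstein distance of order two (the infimum is over all couplings $\Pi$ of $\mathbb Q$ and $\mathbb Q'$, and the norm is Euclidean), and let $\mathcal P_i$ be the set of probability measures $\mathbb Q$ on $\mathbb R^m$ with finite second moment and $d_W(\mathbb Q,\hat{\mathbb P}_{K_i})\le\varepsilon_i$. In the distributionally robust game $G$, agent $i$ minimizes over $x_i\in X_i$ the worst-case cost $$V_i(x)=\sup_{\mathbb Q\in\mathcal P_i}\big\{f_i(x)+\mathbb E_{\xi\sim\mathbb Q}[g_i(x,\xi)]\big\}.$$ A distributionally robust Nash equilibrium (DRNE)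 of $G$ is a point $x^*\in\prod_iX_i$ such that, for each $i$, $x_i^*$ minimizes $V_i(\cdot,x_{-i}^*)$ over $X_i$. **Assumption.** For each $i$: $f_i$ is real-valued and convex in $x_i$ for any $x_{-i}\in\prod_{j\neq i}X_j$; $g_i(x,\xi)=\xi^\top Q_i\xi+P_i(x)^\top\xi$ with $P_i(x)=A_ix+b_i$, $A_i\in\mathbb R^{m\times nN}$, $b_i\in\mathbb R^m$; and $Q_i=L_i^\top D_iL_i$ with $L_i$ orthogonal and $D_i=\operatorname{diag}(d_{i,1},\dots,d_{i,m})$, $d_{i,1}\ge\dots\ge d_{i,m}\ge0$. **Theorem.** For $\lambda_i>\lambda_{\max}(Q_i)$ put $\tilde Q_i(\lambda_i)=\operatorname{diag}\big(\frac1{\lambda_i-d_{i,1}},\dots,\frac1{\lambda_i-d_{i,m}}\big)=(\lambda_iI_m-D_i)^{-1}$, $\tilde W_i^{(k)}(x,\lambda_i)=L_iP_i(x)+2\lambda_iL_i\xi_i^{(k)}$, and $$J_i(x,\lambda_i)=f_i(x)+\lambda_i\Big(\varepsilon_i^2-\frac1{K_i}\sum_{k=1}^{K_i}\|\xi_i^{(k)}\|^2\Big)+\frac1{4K_i}\sum_{k=1}^{K_i}\tilde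 W_i^{(k)}(x,\lambda_i)^\top\tilde Q_i(\lambda_i)\,\tilde W_i^{(k)}(x,\lambda_i).$$ Let $G_R$ be the finite-dimensional game in which agent $i$ chooses $(x_i,\lambda_i)\in X_i\times(\lambda_{\max}(Q_i),\infty)$ to minimize $J_i(x,\lambda_i)$. (It has no epigraphic variables, and its variables and constraints do not depend on the sample or on its size: $\lambda_i$ is the only variable, and $\lambda_i>\lambda_{\max}(Q_i)$ the only constraint, added to those of $X_i$.) Then $G$ admits the reformulation $G_R$ in the following sense. 1. All expectations in the definition of $V_i$ exist, and $V_i(x)=\inf_{\lambda_i>\lambda_{\max}(Q_i)}J_i(x,\lambda_i)$ for all $i$ and all $x\in\mathbb R^{nN}$. 2. Consequently, for all $i$ and all fixed $x_{-i}$, $\inf_{x_i\in X_i}V_i(x_i,x_{-i})=\inf_{x_i\in X_i,\ \lambda_i>\lambda_{\max}(Q_i)}J_i(x_i,x_{-i},\lambda_i)$. 3. A point $(x^*,\lambda^*)$ is a Nash equilibrium of $G_R$ if and only if $x^*$ is a DRNE of $G$ and, for each $i$, $\lambda_i^*$ minimizes $J_i(x^*,\cdot)$ over $(\lambda_{\max}(Q_i),\infty)$.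 In particular, if $(x^*,\lambda^*)$ is a Nash equilibrium of $G_R$, then $x^*$ is a DRNE of $G$. -/

import Mathlib

open MeasureTheory
open scoped ENNReal Matrix

noncomputable section

namespace WassersteinGame

/-! ### Games and Nash equilibria -/

/-- A game with agents `Fin N`, common ambient strategy space `S`, a strategy set for each agent,
and costs (to be minimized) with values in `C`. -/
structure Game (N : ℕ) (S C : Type*) where
  strategies : Fin N → Set S
  cost : Fin N → (Fin N → S) → C

/-- Each `z i` is feasible and minimizes the cost of agent `i` over the strategies of agent `i`,
the decisions of the other agents being fixed. -/
def Game.IsNash {N : ℕ} {S C : Type*} [LE C] (Γ : Game N S C) (z : Fin N → S) : Prop :=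
  ∀ i, z i ∈ Γ.strategies i ∧
    ∀ y ∈ Γ.strategies i, Γ.cost i z ≤ Γ.cost i (Function.update z i y)

/-! ### Wasserstein ambiguity sets -/

/-- Probability measures on `ℝ^m` with finite second moment. -/
def finiteSecondMoment (m : ℕ) : Set (Measure (EuclideanSpace ℝ (Fin m))) :=
  {μ | IsProbabilityMeasure μ ∧ ∫⁻ ξ, ENNReal.ofReal (‖ξ‖ ^ 2) ∂μ < ∞}

/-- Joint distributions with marginals `μ` and `ν`. -/
def couplings {m : ℕ} (μ ν : Measure (EuclideanSpace ℝ (Fin m))) :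
    Set (Measure (EuclideanSpace ℝ (Fin m) × EuclideanSpace ℝ (Fin m))) :=
  {π | π.map Prod.fst = μ ∧ π.map Prod.snd = ν}

/-- The Wasserstein distance of order two, for the Euclidean norm. -/
def wasserstein {m : ℕ} (μ ν : Measure (EuclideanSpace ℝ (Fin m))) : ℝ≥0∞ :=
  (⨅ π ∈ couplings μ ν, ∫⁻ p, ENNReal.ofReal (‖p.1 - p.2‖ ^ 2) ∂π) ^ (1 / 2 : ℝ)

/-- The private data of one agent: a nonempty finite sample and a Wasserstein radius. -/
structure AgentData (m : ℕ) where
  K : ℕ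
  K_pos : 0 < K
  sample : Fin K → EuclideanSpace ℝ (Fin m)
  radius : ℝ
  radius_nonneg : 0 ≤ radius

/-- The empirical distribution `(1 / K) ∑ₖ δ_{ξ⁽ᵏ⁾}`. -/
def AgentData.empirical {m : ℕ} (a : AgentData m) : Measure (EuclideanSpace ℝ (Fin m)) :=
  (a.K : ℝ≥0∞)⁻¹ • ∑ k, Measure.dirac (a.sample k)

/-- The Wasserstein ball around the empirical distribution. -/
def AgentData.ambiguitySet {m : ℕ} (a : AgentData m) :
    Set (Measure (EuclideanSpace ℝ (Fin m))) :=
  {μ | μ ∈ finiteSecondMoment m ∧ wasserstein μ a.empirical ≤ ENNReal.ofReal a.radius}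

/-! ### The distributionally robust game -/

/-- The deterministic ingredients of the game: the decision sets `X i ⊆ ℝ^n`, the costs `f i`, and
the uncertain costs `g i`, as functions of the collective decision (and of the uncertainty). -/
structure Model (N n m : ℕ) where
  X : Fin N → Set (EuclideanSpace ℝ (Fin n))
  f : Fin N → (Fin N → EuclideanSpace ℝ (Fin n)) → ℝ
  g : Fin N → (Fin N → EuclideanSpace ℝ (Fin n)) → EuclideanSpace ℝ (Fin m) → ℝ

/-- The worst-case cost `sup_{μ ∈ 𝒫ᵢ} { fᵢ(x) + 𝔼_{ξ ∼ μ} gᵢ(x, ξ) }`, as an extended real. -/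
def worstCaseCost {N n m : ℕ} (M : Model N n m) (a : Fin N → AgentData m) (i : Fin N)
    (x : Fin N → EuclideanSpace ℝ (Fin n)) : EReal :=
  ⨆ μ ∈ (a i).ambiguitySet, ((M.f i x + ∫ ξ, M.g i x ξ ∂μ : ℝ) : EReal)

/-- The distributionally robust game `G`. Its Nash equilibria are the distributionally robust Nash
equilibria. -/
def robustGame {N n m : ℕ} (M : Model N n m) (a : Fin N → AgentData m) :
    Game N (EuclideanSpace ℝ (Fin n)) EReal where
  strategies := M.X
  cost := worstCaseCost M a

/-! ### The quadratic-bilinear structure -/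

/-- The coefficients of the uncertain cost of one agent: `Q`, the affine map `x ↦ A x + b`, and
the factors `L` and `D = diag d` of `Q = Lᵀ D L`. -/
structure Coefficients (N n m : ℕ) where
  Q : Matrix (Fin m) (Fin m) ℝ
  A : Matrix (Fin m) (Fin N × Fin n) ℝ
  b : Fin m → ℝ
  L : Matrix (Fin m) (Fin m) ℝ
  d : Fin m → ℝ

/-- `P(x) = A x + b`, where `x ∈ ℝ^{nN}` is the collective decision vector. -/
def Coefficients.P {N n m : ℕ} (c : Coefficients N n m)
    (x : Fin N → EuclideanSpace ℝ (Fin n)) : Fin m → ℝ :=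
  c.A *ᵥ (fun p => x p.1 p.2) + c.b

/-- The standing assumption on the costs. -/
structure IsQuadraticBilinear {N n m : ℕ} (M : Model N n m)
    (c : Fin N → Coefficients N n m) : Prop where
  /-- `fᵢ` is convex in `xᵢ`, for all feasible decisions of the other agents. -/
  convex : ∀ i, ∀ x : Fin N → EuclideanSpace ℝ (Fin n), (∀ j, j ≠ i → x j ∈ M.X j) →
    ConvexOn ℝ Set.univ (fun y => M.f i (Function.update x i y))
  /-- `gᵢ(x, ξ) = ξᵀ Qᵢ ξ + Pᵢ(x)ᵀ ξ` with `Pᵢ` affine. -/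
  form : ∀ i x ξ, M.g i x ξ = ξ.ofLp ⬝ᵥ ((c i).Q *ᵥ ξ.ofLp) + (c i).P x ⬝ᵥ ξ.ofLp
  /-- `Qᵢ = Lᵢᵀ Dᵢ Lᵢ` with `Lᵢ` orthogonal and `Dᵢ` diagonal, positive semidefinite, sorted. -/
  orthogonal : ∀ i, (c i).L ∈ Matrix.orthogonalGroup (Fin m) ℝ
  factor : ∀ i, (c i).Q = (c i).Lᵀ * Matrix.diagonal (c i).d * (c i).L
  nonneg : ∀ i j, 0 ≤ (c i).d j
  sorted : ∀ i, Antitone (c i).d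

/-- The largest eigenvalue (of a symmetric real matrix). -/
def lambdaMax {m : ℕ} (Q : Matrix (Fin m) (Fin m) ℝ) : ℝ := sSup (spectrum ℝ Q)

/-! ### The finite-dimensional game -/

/-- `Q̃(l) = diag (1 / (l - d₁), …, 1 / (l - dₘ))`. -/
def Coefficients.Qtilde {N n m : ℕ} (c : Coefficients N n m) (l : ℝ) :
    Matrix (Fin m) (Fin m) ℝ :=
  Matrix.diagonal (fun j => 1 / (l - c.d j))

/-- `W̃(x, l) = L P(x) + 2 l L ξ`, for a sample point `ξ`. -/
def Coefficients.Wtilde {N n m : ℕ} (c : Coefficients N n m)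
    (x : Fin N → EuclideanSpace ℝ (Fin n)) (l : ℝ) (ξ : EuclideanSpace ℝ (Fin m)) : Fin m → ℝ :=
  c.L *ᵥ c.P x + (2 * l) • (c.L *ᵥ ξ.ofLp)

/-- The closed-form cost of agent `i`. -/
def closedFormCost {N n m : ℕ} (M : Model N n m) (c : Fin N → Coefficients N n m)
    (a : Fin N → AgentData m) (i : Fin N) (x : Fin N → EuclideanSpace ℝ (Fin n)) (l : ℝ) : ℝ :=
  M.f i x
    + l * ((a i).radius ^ 2
        - 1 / ((a i).K : ℝ) * ∑ k, ((a i).sample k).ofLp ⬝ᵥ ((a i).sample k).ofLp)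
    + 1 / (4 * ((a i).K : ℝ)) * ∑ k,
        (c i).Wtilde x l ((a i).sample k) ⬝ᵥ
          ((c i).Qtilde l *ᵥ (c i).Wtilde x l ((a i).sample k))

/-- The strategies of agent `i` in the finite-dimensional game: pairs `(xᵢ, lᵢ)` with `xᵢ ∈ Xᵢ`
and `lᵢ > lambdaMax Qᵢ`. There are no further variables, and the only constraint added to those
that define `Xᵢ` is the last one; the data of the agents do not enter. -/
def finiteStrategies {N n m : ℕ} (M : Model N n m) (c : Fin N → Coefficients N n m) (i : Fin N) :
    Set (EuclideanSpace ℝ (Fin n) × ℝ) :=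
  M.X i ×ˢ Set.Ioi (lambdaMax (c i).Q)

/-- The finite-dimensional game `G_R`. -/
def finiteGame {N n m : ℕ} (M : Model N n m) (c : Fin N → Coefficients N n m)
    (a : Fin N → AgentData m) : Game N (EuclideanSpace ℝ (Fin n) × ℝ) ℝ where
  strategies := finiteStrategies M c
  cost := fun i z => closedFormCost M c a i (fun j => (z j).1) (z i).2

end WassersteinGame

end

namespace WassersteinGame

open Filter Topology

/-! ### Duality for a separable quadratic function on a ball -/

theorem quadratic_le_dual {d c l v : ℝ} (h : d < l) :
    d * v ^ 2 + c * v ≤ l * v ^ 2 + c ^ 2 / (4 * (l - d)) := by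
  have hp : 0 < l - d := sub_pos.mpr h
  have : l * v ^ 2 + c ^ 2 / (4 * (l - d)) - (d * v ^ 2 + c * v)
      = (2 * (l - d) * v - c) ^ 2 / (4 * (l - d)) := by
    field_simp
    ring
  have : 0 ≤ (2 * (l - d) * v - c) ^ 2 / (4 * (l - d)) := by positivity
  linarith

theorem quadratic_eq_dual (d c l : ℝ) :
    d * (c / (2 * (l - d))) ^ 2 + c * (c / (2 * (l - d)))
      = l * (c / (2 * (l - d))) ^ 2 + c ^ 2 / (4 * (l - d)) := by
  by_cases hd : l - d = 0
  · simp [hd]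
  · field_simp
    ring

section SeparableQuadratic

variable {ι : Type*} [Fintype ι]

theorem tendsto_dual_atTop (d c : ι → ℝ) :
    Tendsto (fun l => ∑ i, c i ^ 2 / (4 * (l - d i))) atTop (𝓝 0) := by
  suffices h : ∀ i, Tendsto (fun l => c i ^ 2 / (4 * (l - d i))) atTop (𝓝 0) by
    simpa using tendsto_finsetSum Finset.univ fun i _ => h i
  refine fun i => Tendsto.const_div_atTop ?_ _
  exact (tendsto_atTop_add_const_right _ (-d i) tendsto_id).const_mul_atTop (by norm_num)

theorem tendsto_displacement_atTop (d c : ι → ℝ) :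
    Tendsto (fun l => ∑ i, (c i / (2 * (l - d i))) ^ 2) atTop (𝓝 0) := by
  suffices h : ∀ i, Tendsto (fun l => (c i / (2 * (l - d i))) ^ 2) atTop (𝓝 0) by
    simpa using tendsto_finsetSum Finset.univ fun i _ => h i
  intro i
  have : Tendsto (fun l => c i / (2 * (l - d i))) atTop (𝓝 0) :=
    Tendsto.const_div_atTop
      ((tendsto_atTop_add_const_right _ (-d i) tendsto_id).const_mul_atTop (by norm_num)) _
  simpa using this.pow 2

theorem continuousOn_displacement {d c : ι → ℝ} {D : ℝ} (hd : ∀ i, d i ≤ D) :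
    ContinuousOn (fun l => ∑ i, (c i / (2 * (l - d i))) ^ 2) (Set.Ioi D) := by
  refine continuousOn_finsetSum _ fun i _ => ContinuousOn.pow ?_ 2
  refine continuousOn_const.div (by fun_prop) fun l hl => ?_
  have : 0 < l - d i := sub_pos.mpr ((hd i).trans_lt hl)
  positivity

/-- Strong duality with attainment for a separable quadratic function on a ball. -/
theorem exists_dual_bound_le {d c : ι → ℝ} {D r B : ℝ} (hd : ∀ i, d i ≤ D)
    (hD : ∃ i, d i = D) (hr : 0 ≤ r)
    (hB : ∀ l, D < l → B ≤ l * r + ∑ i, c i ^ 2 / (4 * (l - d i))) :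
    ∃ v : ι → ℝ, ∑ i, v i ^ 2 ≤ r ∧ B ≤ ∑ i, (d i * v i ^ 2 + c i * v i) := by
  classical
  obtain rfl | hr := hr.eq_or_lt
  · refine ⟨0, by simp, ?_⟩
    simp only [mul_zero, zero_add] at hB
    simpa using ge_of_tendsto (tendsto_dual_atTop d c)
      ((eventually_gt_atTop D).mono hB)
  by_cases hex : ∃ l, D < l ∧ r ≤ ∑ i, (c i / (2 * (l - d i))) ^ 2
  · obtain ⟨l₁, hl₁, hr₁⟩ := hex
    obtain ⟨l₂, hl₂, hr₂⟩ := ((eventually_gt_atTop l₁).and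
      ((tendsto_displacement_atTop d c).eventually_lt_const hr)).exists
    obtain ⟨l, hl, hlr⟩ := intermediate_value_Icc' hl₂.le
      ((continuousOn_displacement (c := c) hd).mono
        fun y hy => hl₁.trans_le hy.1) ⟨hr₂.le, hr₁⟩
    have hDl : D < l := hl₁.trans_le hl.1
    refine ⟨fun i => c i / (2 * (l - d i)), hlr.le, (hB l hDl).trans_eq ?_⟩
    rw [Finset.sum_congr rfl fun i _ => quadratic_eq_dual (d i) (c i) l, Finset.sum_add_distrib,
      ← Finset.mul_sum]
    simp only at hlr
    rw [hlr]
  push Not at hex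
  have hc : ∀ i, D - d i = 0 → c i = 0 := by
    intro i hi
    have hlim : Tendsto (fun l => 4 * (l - D) ^ 2 * r) (𝓝[>] D) (𝓝 0) := by
      have : Continuous fun l : ℝ => 4 * (l - D) ^ 2 * r := by fun_prop
      simpa using (this.tendsto D).mono_left nhdsWithin_le_nhds
    have hle : c i ^ 2 ≤ 0 := by
      refine ge_of_tendsto hlim (eventually_mem_nhdsWithin.mono fun l hl => ?_)
      have hp : 0 < l - D := sub_pos.mpr hl
      have h1 : (c i / (2 * (l - d i))) ^ 2 ≤ r :=
        (Finset.single_le_sum (f := fun i => (c i / (2 * (l - d i))) ^ 2)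
          (fun i _ => sq_nonneg _) (Finset.mem_univ i)).trans (hex l hl).le
      rw [show d i = D by linarith, div_pow, div_le_iff₀ (by positivity)] at h1
      linarith
    exact pow_eq_zero_iff two_ne_zero |>.mp (le_antisymm hle (sq_nonneg _))
  have hdual : Tendsto (fun l => l * r + ∑ i, c i ^ 2 / (4 * (l - d i))) (𝓝[>] D)
      (𝓝 (D * r + ∑ i, c i ^ 2 / (4 * (D - d i)))) := by
    refine (Continuous.tendsto (by fun_prop) D |>.mono_left nhdsWithin_le_nhds).add
      (tendsto_finsetSum _ fun i _ => ?_)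
    by_cases hi : D - d i = 0
    · simp [hc i hi]
    · refine Tendsto.mono_left (ContinuousAt.tendsto ?_) nhdsWithin_le_nhds
      exact continuousAt_const.div (by fun_prop) (by simpa using hi)
  have hdisp : Tendsto (fun l => ∑ i, (c i / (2 * (l - d i))) ^ 2) (𝓝[>] D)
      (𝓝 (∑ i, (c i / (2 * (D - d i))) ^ 2)) := by
    refine tendsto_finsetSum _ fun i _ => ?_
    by_cases hi : D - d i = 0
    · simp [hc i hi]
    · refine Tendsto.mono_left (ContinuousAt.tendsto ?_) nhdsWithin_le_nhds
      exact (continuousAt_const.div (by fun_prop) (by simpa using hi)).pow 2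
  have hBD := ge_of_tendsto hdual (eventually_mem_nhdsWithin.mono hB)
  have hrD := le_of_tendsto hdisp (eventually_mem_nhdsWithin.mono fun l hl => (hex l hl).le)
  obtain ⟨i₀, hi₀⟩ := hD
  have hc₀ : c i₀ = 0 := hc i₀ (by simp [hi₀])
  set s := r - ∑ i, (c i / (2 * (D - d i))) ^ 2 with hs
  have hs₀ : 0 ≤ s := sub_nonneg.mpr hrD
  have hsq : √s ^ 2 = s := Real.sq_sqrt hs₀
  refine ⟨fun i => c i / (2 * (D - d i)) + if i = i₀ then √s else 0, ?_, hBD.trans_eq ?_⟩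
  · have : ∀ i, (c i / (2 * (D - d i)) + if i = i₀ then √s else 0) ^ 2
        = (c i / (2 * (D - d i))) ^ 2 + if i = i₀ then s else 0 := by
      intro i
      split_ifs with h
      · subst h; simp [hc₀, hsq]
      · simp
    simp only [this, Finset.sum_add_distrib, Finset.sum_ite_eq', Finset.mem_univ, if_true]
    linarith
  · have : ∀ i, d i * (c i / (2 * (D - d i)) + if i = i₀ then √s else 0) ^ 2
          + c i * (c i / (2 * (D - d i)) + if i = i₀ then √s else 0)
        = D * (c i / (2 * (D - d i))) ^ 2 + c i ^ 2 / (4 * (D - d i))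
          + if i = i₀ then D * s else 0 := by
      intro i
      split_ifs with h
      · subst h; simp [hc₀, hsq, hi₀]
      · simpa using quadratic_eq_dual (d i) (c i) D
    simp only [this, Finset.sum_add_distrib, Finset.sum_ite_eq', Finset.mem_univ, if_true,
      ← Finset.mul_sum]
    rw [hs]; ring

end SeparableQuadratic

/-! ### Averages of Dirac masses -/

/-- The average of the Dirac masses at the points of a finite family. -/
noncomputable def averageDirac {α : Type*} [MeasurableSpace α] {K : ℕ} (s : Fin K → α) :
    Measure α :=
  (K : ℝ≥0∞)⁻¹ • ∑ k, Measure.dirac (s k)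

section averageDirac

variable {α β : Type*} [MeasurableSpace α] [MeasurableSpace β] {K : ℕ}

theorem isProbabilityMeasure_averageDirac (hK : 0 < K) (s : Fin K → α) :
    IsProbabilityMeasure (averageDirac s) := by
  constructor
  simp only [averageDirac, Measure.smul_apply, Measure.finsetSum_apply, measure_univ,
    Finset.sum_const, Finset.card_univ, Fintype.card_fin, smul_eq_mul, nsmul_eq_mul, mul_one]
  exact ENNReal.inv_mul_cancel (by simpa using hK.ne') (by simp)

theorem map_averageDirac {f : α → β} (hf : Measurable f) (s : Fin K → α) :
    (averageDirac s).map f = averageDirac (f ∘ s) := by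
  simp [averageDirac, Measure.map_smul, Measure.map_finset_sum hf.aemeasurable,
    Measure.map_dirac' hf]

theorem integrable_averageDirac [MeasurableSingletonClass α] (hK : 0 < K) (s : Fin K → α)
    (f : α → ℝ) : Integrable f (averageDirac s) :=
  (integrable_finsetSum_measure.mpr fun _ _ => integrable_dirac (by simp)).smul_measure
    (by simpa using hK.ne')

theorem integral_averageDirac [MeasurableSingletonClass α] (s : Fin K → α) (f : α → ℝ) :
    ∫ x, f x ∂averageDirac s = (K : ℝ)⁻¹ * ∑ k, f (s k) := by
  rw [averageDirac, integral_smul_measure,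
    integral_finsetSum_measure fun _ _ => integrable_dirac (by simp)]
  simp

theorem lintegral_ofReal_averageDirac [MeasurableSingletonClass α] (hK : 0 < K) (s : Fin K → α)
    {f : α → ℝ} (hf : ∀ x, 0 ≤ f x) :
    ∫⁻ x, ENNReal.ofReal (f x) ∂averageDirac s
      = ENNReal.ofReal ((K : ℝ)⁻¹ * ∑ k, f (s k)) := by
  rw [← integral_averageDirac, ofReal_integral_eq_lintegral_ofReal
    (integrable_averageDirac hK s f) (Eventually.of_forall hf)]

end averageDirac

/-! ### Expectations over a Wasserstein ball -/

section Ambiguity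

variable {m : ℕ} {a : AgentData m} {μ : Measure (EuclideanSpace ℝ (Fin m))}

theorem AgentData.empirical_eq_averageDirac (a : AgentData m) :
    a.empirical = averageDirac a.sample := rfl

theorem integrable_norm_sq (hμ : μ ∈ finiteSecondMoment m) :
    Integrable (fun ξ => ‖ξ‖ ^ 2) μ := by
  refine ⟨by fun_prop, ?_⟩
  rw [hasFiniteIntegral_iff_ofReal (Eventually.of_forall fun ξ => by positivity)]
  exact hμ.2

theorem exists_coupling_of_lt (hμ : μ ∈ a.ambiguitySet) {η : ℝ} (hη : a.radius ^ 2 < η) :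
    ∃ π ∈ couplings μ a.empirical,
      ∫⁻ p, ENNReal.ofReal (‖p.1 - p.2‖ ^ 2) ∂π < ENNReal.ofReal η := by
  have h := ENNReal.rpow_le_rpow hμ.2 (z := 2) (by norm_num)
  rw [wasserstein, ← ENNReal.rpow_mul] at h
  norm_num at h
  rw [← ENNReal.ofReal_pow a.radius_nonneg] at h
  have hlt := h.trans_lt
    ((ENNReal.ofReal_lt_ofReal_iff_of_nonneg (sq_nonneg _)).mpr hη)
  simpa [iInf_lt_iff] using hlt

/-- Weak duality: a bound of `g` by a multiple of the transport cost plus a function of the sample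
point bounds the expectation of `g` over the Wasserstein ball. -/
theorem integral_le_of_mem_ambiguitySet (hμ : μ ∈ a.ambiguitySet)
    {g φ : EuclideanSpace ℝ (Fin m) → ℝ} {l : ℝ} (hl : 0 ≤ l) (hg : Integrable g μ)
    (h : ∀ ξ ξ', g ξ ≤ l * ‖ξ - ξ'‖ ^ 2 + φ ξ') :
    ∫ ξ, g ξ ∂μ ≤ l * a.radius ^ 2 + (a.K : ℝ)⁻¹ * ∑ k, φ (a.sample k) := by
  have hlim : Tendsto (fun η => l * η + (a.K : ℝ)⁻¹ * ∑ k, φ (a.sample k))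
      (𝓝[>] (a.radius ^ 2))
      (𝓝 (l * a.radius ^ 2 + (a.K : ℝ)⁻¹ * ∑ k, φ (a.sample k))) :=
    (Continuous.tendsto (by fun_prop) _).mono_left nhdsWithin_le_nhds
  refine ge_of_tendsto hlim (eventually_mem_nhdsWithin.mono fun η hη => ?_)
  obtain ⟨π, ⟨hfst, hsnd⟩, hπ⟩ := exists_coupling_of_lt hμ hη
  have hη₀ : 0 ≤ η := (sq_nonneg _).trans (le_of_lt hη)
  have hg' : Integrable (fun p => g p.1) π := by
    rw [← hfst] at hg
    exact hg.comp_measurable measurable_fst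
  have hφi : Integrable φ (π.map Prod.snd) := by
    rw [hsnd]; exact integrable_averageDirac a.K_pos _ _
  have hφ' : Integrable (fun p => φ p.2) π := hφi.comp_measurable measurable_snd
  have hpos : 0 ≤ᵐ[π] fun p => ‖p.1 - p.2‖ ^ 2 := Eventually.of_forall fun p => by positivity
  have hc : Integrable (fun p => ‖p.1 - p.2‖ ^ 2) π := by
    refine ⟨by fun_prop, ?_⟩
    rw [hasFiniteIntegral_iff_ofReal hpos]
    exact hπ.trans ENNReal.ofReal_lt_top
  have hcη : ∫ p, ‖p.1 - p.2‖ ^ 2 ∂π ≤ η := by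
    rw [integral_eq_lintegral_of_nonneg_ae hpos hc.1]
    exact ENNReal.toReal_le_of_le_ofReal hη₀ hπ.le
  calc ∫ ξ, g ξ ∂μ = ∫ p, g p.1 ∂π := by
        rw [← hfst] at hg ⊢
        exact integral_map measurable_fst.aemeasurable hg.1
    _ ≤ ∫ p, (l * ‖p.1 - p.2‖ ^ 2 + φ p.2) ∂π :=
        integral_mono hg' ((hc.const_mul l).add hφ') fun p => h p.1 p.2
    _ = l * ∫ p, ‖p.1 - p.2‖ ^ 2 ∂π + ∫ ξ, φ ξ ∂a.empirical := by
        rw [integral_add (hc.const_mul l) hφ', integral_const_mul, ← hsnd,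
          integral_map measurable_snd.aemeasurable hφi.1]
    _ ≤ l * η + (a.K : ℝ)⁻¹ * ∑ k, φ (a.sample k) := by
        rw [a.empirical_eq_averageDirac, integral_averageDirac]
        gcongr

/-- Moving the sample points within the transport budget stays in the Wasserstein ball. -/
theorem averageDirac_mem_ambiguitySet {s : Fin a.K → EuclideanSpace ℝ (Fin m)}
    (hs : ∑ k, ‖s k - a.sample k‖ ^ 2 ≤ a.K * a.radius ^ 2) :
    averageDirac s ∈ a.ambiguitySet := by
  have hK : (0 : ℝ) < a.K := by exact_mod_cast a.K_pos
  refine ⟨⟨isProbabilityMeasure_averageDirac a.K_pos s, ?_⟩, ?_⟩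
  · rw [lintegral_ofReal_averageDirac a.K_pos s fun ξ => by positivity]
    exact ENNReal.ofReal_lt_top
  · have hmem : averageDirac (fun k => (s k, a.sample k)) ∈
        couplings (averageDirac s) a.empirical :=
      ⟨map_averageDirac measurable_fst _, map_averageDirac measurable_snd _⟩
    have hle : ⨅ π ∈ couplings (averageDirac s) a.empirical,
        ∫⁻ p, ENNReal.ofReal (‖p.1 - p.2‖ ^ 2) ∂π ≤ ENNReal.ofReal a.radius ^ (2 : ℝ) := by
      refine (iInf₂_le _ hmem).trans ?_
      rw [lintegral_ofReal_averageDirac a.K_pos _ fun p => by positivity,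
        ENNReal.rpow_two, ← ENNReal.ofReal_pow a.radius_nonneg]
      refine ENNReal.ofReal_le_ofReal ?_
      rwa [inv_mul_le_iff₀ hK]
    refine (ENNReal.rpow_le_rpow hle (by norm_num)).trans_eq ?_
    rw [← ENNReal.rpow_mul]
    norm_num

end Ambiguity

/-! ### The uncertain cost in the coordinates that diagonalize it -/

section Coordinates

open Matrix

theorem mulVec_dotProduct_mulVec_of_orthogonal {m : ℕ} {L : Matrix (Fin m) (Fin m) ℝ}
    (hL : L ∈ orthogonalGroup (Fin m) ℝ) (u v : Fin m → ℝ) :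
    (L *ᵥ u) ⬝ᵥ (L *ᵥ v) = u ⬝ᵥ v := by
  rw [dotProduct_mulVec, vecMul_mulVec, ← mulVec_transpose]
  have : Lᵀ * L = 1 := (mem_orthogonalGroup_iff' (Fin m) ℝ).mp hL
  simp [this]

theorem continuous_mulVec_ofLp_apply {m : ℕ} (L : Matrix (Fin m) (Fin m) ℝ) (j : Fin m) :
    Continuous fun ξ : EuclideanSpace ℝ (Fin m) => (L *ᵥ ξ.ofLp) j :=
  (continuous_apply j).comp
    (Continuous.matrix_mulVec continuous_const (PiLp.continuous_ofLp 2 _))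

theorem lambdaMax_eq {m : ℕ} (hm : 0 < m) {L : Matrix (Fin m) (Fin m) ℝ} {d : Fin m → ℝ}
    (hL : L ∈ orthogonalGroup (Fin m) ℝ) (hd : Antitone d) :
    lambdaMax (Lᵀ * diagonal d * L) = d ⟨0, hm⟩ := by
  have h1 : Lᵀ * L = 1 := (mem_orthogonalGroup_iff' (Fin m) ℝ).mp hL
  have h2 : L * Lᵀ = 1 := (mem_orthogonalGroup_iff (Fin m) ℝ).mp hL
  have hspec : spectrum ℝ (Lᵀ * diagonal d * L) = Set.range d := by
    rw [← spectrum_diagonal]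
    exact spectrum.units_conjugate' (u := ⟨L, Lᵀ, h2, h1⟩)
  have hgreatest : IsGreatest (Set.range d) (d ⟨0, hm⟩) := by
    refine ⟨⟨_, rfl⟩, ?_⟩
    rintro _ ⟨j, rfl⟩
    exact hd (Fin.mk_le_of_le_val (Nat.zero_le _))
  rw [lambdaMax, hspec, hgreatest.csSup_eq]

variable {N n m : ℕ}

/-- The gradient of `ξ ↦ ξᵀ Q ξ + P(x)ᵀ ξ` at `ξ`, in the coordinates given by `L`. -/
noncomputable def Coefficients.slope (c : Coefficients N n m)
    (x : Fin N → EuclideanSpace ℝ (Fin n)) (ξ : EuclideanSpace ℝ (Fin m)) (j : Fin m) : ℝ :=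
  (c.L *ᵥ c.P x) j + 2 * c.d j * (c.L *ᵥ ξ.ofLp) j

variable {M : Model N n m} {c : Fin N → Coefficients N n m} (hA : IsQuadraticBilinear M c)
include hA

theorem IsQuadraticBilinear.g_eq_sum (i : Fin N) (x : Fin N → EuclideanSpace ℝ (Fin n))
    (ξ : EuclideanSpace ℝ (Fin m)) :
    M.g i x ξ = ∑ j, ((c i).d j * ((c i).L *ᵥ ξ.ofLp) j ^ 2
      + ((c i).L *ᵥ (c i).P x) j * ((c i).L *ᵥ ξ.ofLp) j) := by
  rw [hA.form, hA.factor, ← mulVec_dotProduct_mulVec_of_orthogonal (hA.orthogonal i) _ ξ.ofLp,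
    ← mulVec_mulVec, ← mulVec_mulVec, dotProduct_mulVec, vecMul_transpose,
    Finset.sum_add_distrib]
  congr 1
  simp only [dotProduct, mulVec_diagonal]
  exact Finset.sum_congr rfl fun j _ => by ring

theorem IsQuadraticBilinear.norm_sq_eq_sum (i : Fin N) (ξ : EuclideanSpace ℝ (Fin m)) :
    ‖ξ‖ ^ 2 = ∑ j, ((c i).L *ᵥ ξ.ofLp) j ^ 2 := by
  rw [EuclideanSpace.real_norm_sq_eq]
  simpa [dotProduct, sq] using
    (mulVec_dotProduct_mulVec_of_orthogonal (hA.orthogonal i) ξ.ofLp ξ.ofLp).symm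

theorem IsQuadraticBilinear.g_add (i : Fin N) (x : Fin N → EuclideanSpace ℝ (Fin n))
    (ξ v : EuclideanSpace ℝ (Fin m)) :
    M.g i x (ξ + v) = M.g i x ξ + ∑ j, ((c i).d j * ((c i).L *ᵥ v.ofLp) j ^ 2
      + (c i).slope x ξ j * ((c i).L *ᵥ v.ofLp) j) := by
  rw [hA.g_eq_sum, hA.g_eq_sum, ← Finset.sum_add_distrib]
  refine Finset.sum_congr rfl fun j _ => ?_
  simp only [WithLp.ofLp_add, mulVec_add, Pi.add_apply, Coefficients.slope]
  ring

theorem IsQuadraticBilinear.d_le_lambdaMax (i : Fin N) (j : Fin m) :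
    (c i).d j ≤ lambdaMax (c i).Q := by
  rw [hA.factor, lambdaMax_eq (Nat.zero_lt_of_lt j.2) (hA.orthogonal i) (hA.sorted i)]
  exact hA.sorted i (Fin.mk_le_of_le_val (Nat.zero_le _))

theorem IsQuadraticBilinear.g_le (i : Fin N) (x : Fin N → EuclideanSpace ℝ (Fin n)) {l : ℝ}
    (hl : lambdaMax (c i).Q < l) (ξ ξ' : EuclideanSpace ℝ (Fin m)) :
    M.g i x ξ ≤ l * ‖ξ - ξ'‖ ^ 2 + (M.g i x ξ'
      + ∑ j, (c i).slope x ξ' j ^ 2 / (4 * (l - (c i).d j))) := by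
  have h := hA.g_add i x ξ' (ξ - ξ')
  rw [add_sub_cancel] at h
  have hle : ∑ j, ((c i).d j * ((c i).L *ᵥ (ξ - ξ').ofLp) j ^ 2
      + (c i).slope x ξ' j * ((c i).L *ᵥ (ξ - ξ').ofLp) j) ≤ l * ‖ξ - ξ'‖ ^ 2
      + ∑ j, (c i).slope x ξ' j ^ 2 / (4 * (l - (c i).d j)) := by
    rw [hA.norm_sq_eq_sum i, Finset.mul_sum, ← Finset.sum_add_distrib]
    exact Finset.sum_le_sum fun j _ =>
      quadratic_le_dual ((hA.d_le_lambdaMax i j).trans_lt hl)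
  linarith

theorem IsQuadraticBilinear.integrable_g (i : Fin N) (x : Fin N → EuclideanSpace ℝ (Fin n))
    {μ : Measure (EuclideanSpace ℝ (Fin m))} (hμ : μ ∈ finiteSecondMoment m) :
    Integrable (M.g i x) μ := by
  have := hμ.1
  have hcoord : ∀ j, MemLp (fun ξ : EuclideanSpace ℝ (Fin m) => ((c i).L *ᵥ ξ.ofLp) j) 2 μ := by
    intro j
    have hcont := continuous_mulVec_ofLp_apply (c i).L j
    rw [memLp_two_iff_integrable_sq hcont.aestronglyMeasurable]
    refine (integrable_norm_sq hμ).mono' (by fun_prop) (Eventually.of_forall fun ξ => ?_)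
    rw [hA.norm_sq_eq_sum i, Real.norm_of_nonneg (sq_nonneg _)]
    exact Finset.single_le_sum (f := fun j => ((c i).L *ᵥ ξ.ofLp) j ^ 2)
      (fun j _ => sq_nonneg _) (Finset.mem_univ j)
  rw [funext (hA.g_eq_sum i x)]
  exact integrable_finsetSum _ fun j _ =>
    ((hcoord j).integrable_sq.const_mul _).add
      (((hcoord j).integrable (by norm_num)).const_mul _)

theorem IsQuadraticBilinear.closedFormCost_eq (a : Fin N → AgentData m) (i : Fin N)
    (x : Fin N → EuclideanSpace ℝ (Fin n)) {l : ℝ} (hl : lambdaMax (c i).Q < l) :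
    closedFormCost M c a i x l = M.f i x + (l * (a i).radius ^ 2 + ((a i).K : ℝ)⁻¹ *
      ∑ k, (M.g i x ((a i).sample k)
        + ∑ j, (c i).slope x ((a i).sample k) j ^ 2 / (4 * (l - (c i).d j)))) := by
  have key : ∀ ξ : EuclideanSpace ℝ (Fin m),
      (c i).Wtilde x l ξ ⬝ᵥ ((c i).Qtilde l *ᵥ (c i).Wtilde x l ξ)
        = 4 * (M.g i x ξ + ∑ j, (c i).slope x ξ j ^ 2 / (4 * (l - (c i).d j))
          + l * (ξ.ofLp ⬝ᵥ ξ.ofLp)) := by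
    intro ξ
    rw [← mulVec_dotProduct_mulVec_of_orthogonal (hA.orthogonal i) ξ.ofLp, hA.g_eq_sum]
    simp only [dotProduct, Coefficients.Qtilde, Coefficients.Wtilde, Coefficients.slope,
      mulVec_diagonal, Finset.mul_sum, ← Finset.sum_add_distrib, Pi.add_apply, Pi.smul_apply,
      smul_eq_mul]
    refine Finset.sum_congr rfl fun j _ => ?_
    have : l - (c i).d j ≠ 0 := (sub_pos.mpr ((hA.d_le_lambdaMax i j).trans_lt hl)).ne'
    field_simp
    ring
  have hK : ((a i).K : ℝ) ≠ 0 := by exact_mod_cast (a i).K_pos.ne'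
  simp only [closedFormCost, key, ← Finset.mul_sum]
  rw [Finset.sum_add_distrib (g := fun k => l * _), ← Finset.mul_sum]
  field_simp
  ring

theorem IsQuadraticBilinear.worstCaseCost_eq (hm : 0 < m) (a : Fin N → AgentData m) (i : Fin N)
    (x : Fin N → EuclideanSpace ℝ (Fin n)) :
    worstCaseCost M a i x =
      ⨅ l ∈ Set.Ioi (lambdaMax (c i).Q), (closedFormCost M c a i x l : EReal) := by
  have hK : (0 : ℝ) < (a i).K := by exact_mod_cast (a i).K_pos
  have hmax : lambdaMax (c i).Q = (c i).d ⟨0, hm⟩ := by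
    rw [hA.factor, lambdaMax_eq hm (hA.orthogonal i) (hA.sorted i)]
  apply le_antisymm
  · refine iSup₂_le fun μ hμ => le_iInf₂ fun l hl => EReal.coe_le_coe_iff.mpr ?_
    rw [hA.closedFormCost_eq a i x hl]
    have hl₀ : 0 ≤ l := ((hA.nonneg i ⟨0, hm⟩).trans (hA.d_le_lambdaMax i _)).trans (le_of_lt hl)
    have := integral_le_of_mem_ambiguitySet hμ hl₀ (hA.integrable_g i x hμ.1)
      (hA.g_le i x hl)
    linarith
  · refine EReal.ge_of_forall_gt_iff_ge.mp fun B hB => ?_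
    have hBl : ∀ l, lambdaMax (c i).Q < l →
        (a i).K * (B - M.f i x) - ∑ k, M.g i x ((a i).sample k)
          ≤ l * ((a i).K * (a i).radius ^ 2) + ∑ p : Fin (a i).K × Fin m,
            (c i).slope x ((a i).sample p.1) p.2 ^ 2 / (4 * (l - (c i).d p.2)) := by
      intro l hl
      have h := EReal.coe_lt_coe_iff.mp (hB.trans_le (iInf₂_le l hl))
      rw [hA.closedFormCost_eq a i x hl, Finset.sum_add_distrib, ← Fintype.sum_prod_type'] at h
      have h' := mul_le_mul_of_nonneg_left h.le hK.le
      field_simp at h'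
      linarith
    obtain ⟨v, hv, hBv⟩ := exists_dual_bound_le (fun p => hA.d_le_lambdaMax i p.2)
      ⟨(⟨0, (a i).K_pos⟩, ⟨0, hm⟩), hmax.symm⟩ (by positivity) hBl
    set w : Fin (a i).K → EuclideanSpace ℝ (Fin m) :=
      fun k => WithLp.toLp 2 ((c i).Lᵀ *ᵥ fun j => v (k, j)) with hw
    have hLw : ∀ k, (c i).L *ᵥ (w k).ofLp = fun j => v (k, j) := fun k => by
      rw [hw, mulVec_mulVec, (mem_orthogonalGroup_iff (Fin m) ℝ).mp (hA.orthogonal i),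
        one_mulVec]
    have hmem : averageDirac (fun k => (a i).sample k + w k) ∈ (a i).ambiguitySet := by
      refine averageDirac_mem_ambiguitySet (le_trans (le_of_eq ?_) hv)
      simp only [add_sub_cancel_left, hA.norm_sq_eq_sum i, hLw, Fintype.sum_prod_type]
    refine le_trans (EReal.coe_le_coe_iff.mpr ?_) (le_iSup₂_of_le _ hmem le_rfl)
    rw [integral_averageDirac]
    simp only [hA.g_add, hLw]
    rw [Finset.sum_add_distrib, ← Fintype.sum_prod_type' (f := fun k j =>
      (c i).d j * v (k, j) ^ 2 + (c i).slope x ((a i).sample k) j * v (k, j)), ← sub_le_iff_le_add',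
      le_inv_mul_iff₀ hK]
    linarith

end Coordinates

end WassersteinGame

theorem theorem1 {N n m : ℕ} (hm : 0 < m)
    (M : WassersteinGame.Model N n m)
    (a : Fin N → WassersteinGame.AgentData m)
    (c : Fin N → WassersteinGame.Coefficients N n m)
    (hA : WassersteinGame.IsQuadraticBilinear M c) :
    -- all expectations in the original game exist
    (∀ i x, ∀ μ ∈ (a i).ambiguitySet, MeasureTheory.Integrable (M.g i x) μ) ∧
    -- the worst-case cost is the infimum of the closed-form cost over the multiplier
    (∀ i x, WassersteinGame.worstCaseCost M a i x =
      ⨅ l ∈ Set.Ioi (WassersteinGame.lambdaMax (c i).Q),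
        (WassersteinGame.closedFormCost M c a i x l : EReal)) ∧
    -- for fixed decisions of the other agents, the two problems of agent `i` have the same value
    (∀ i x, (⨅ y ∈ M.X i, WassersteinGame.worstCaseCost M a i (Function.update x i y)) =
      ⨅ w ∈ WassersteinGame.finiteStrategies M c i,
        (WassersteinGame.closedFormCost M c a i (Function.update x i w.1) w.2 : EReal)) ∧
    -- the equilibria of the finite-dimensional game are the pairs of an equilibrium of the
    -- original game and optimal multipliers
    (∀ z : Fin N → EuclideanSpace ℝ (Fin n) × ℝ,
      (WassersteinGame.finiteGame M c a).IsNash z ↔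
        (WassersteinGame.robustGame M a).IsNash (fun i => (z i).1) ∧
        ∀ i, (z i).2 ∈ Set.Ioi (WassersteinGame.lambdaMax (c i).Q) ∧
          ∀ l ∈ Set.Ioi (WassersteinGame.lambdaMax (c i).Q),
            WassersteinGame.closedFormCost M c a i (fun j => (z j).1) (z i).2 ≤
              WassersteinGame.closedFormCost M c a i (fun j => (z j).1) l) := by
  have hV := hA.worstCaseCost_eq hm a
  have hle : ∀ i x l, l ∈ Set.Ioi (WassersteinGame.lambdaMax (c i).Q) →
      WassersteinGame.worstCaseCost M a i x ≤ WassersteinGame.closedFormCost M c a i x l :=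
    fun i x l hl => (hV i x).trans_le (iInf₂_le l hl)
  have hfst : ∀ (z : Fin N → EuclideanSpace ℝ (Fin n) × ℝ) i w,
      (fun j => (Function.update z i w j).1) = Function.update (fun j => (z j).1) i w.1 :=
    fun z i w => (Function.comp_update Prod.fst z i w)
  refine ⟨fun i x μ hμ => hA.integrable_g i x hμ.1, hV, fun i x => ?_, fun z => ⟨fun h => ?_, ?_⟩⟩
  · simp only [hV]
    exact (biInf_prod (f := fun w : EuclideanSpace ℝ (Fin n) × ℝ =>
      (WassersteinGame.closedFormCost M c a i (Function.update x i w.1) w.2 : EReal))).symm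
  · have hmin : ∀ i, ∀ y ∈ M.X i, ∀ l ∈ Set.Ioi (WassersteinGame.lambdaMax (c i).Q),
        WassersteinGame.closedFormCost M c a i (fun j => (z j).1) (z i).2 ≤
          WassersteinGame.closedFormCost M c a i (Function.update (fun j => (z j).1) i y) l := by
      intro i y hy l hl
      have := (h i).2 (y, l) ⟨hy, hl⟩
      simpa only [WassersteinGame.finiteGame, hfst, Function.update_self] using this
    refine ⟨fun i => ⟨(h i).1.1, fun y hy => ?_⟩, fun i => ⟨(h i).1.2, fun l hl => ?_⟩⟩
    · refine (hle i _ _ (h i).1.2).trans ?_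
      refine le_of_le_of_eq ?_ (hV i _).symm
      exact le_iInf₂ fun l hl => EReal.coe_le_coe_iff.mpr (hmin i y hy l hl)
    · simpa only [Function.update_eq_self] using
        hmin i (Function.update (fun j => (z j).1) i (z i).1 i) (by simpa using (h i).1.1) l hl
  · rintro ⟨hN, hl⟩ i
    refine ⟨⟨(hN i).1, (hl i).1⟩, fun w hw => ?_⟩
    simp only [WassersteinGame.finiteGame, hfst, Function.update_self]
    rw [← EReal.coe_le_coe_iff]
    calc _ ≤ WassersteinGame.worstCaseCost M a i (fun j => (z j).1) := by
          rw [hV]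
          exact le_iInf₂ fun l hl' => EReal.coe_le_coe_iff.mpr ((hl i).2 l hl')
      _ ≤ _ := (hN i).2 w.1 hw.1
      _ ≤ _ := hle i _ _ hw.2
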